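/- All rings are commutative with $1$. A quasi-identity is a universally quantified implication $(s_1=t_1)\wedge\cdots\wedge(s_k=t_k)\to(s_0=t_0)$ between terms in the operations $+,\cdot,-,0,1$ ($k=0$ is allowed and gives an identity). A quasivariety is a class of algebras in these operations axiomatized by a set of quasi-identities, and the quasivariety generated by a class is the smallest quasivariety containing it. If $\mathcal Q$ is a quasivariety of commutative rings and $R\in\mathcal Q$, then an ideal $I$ of $R$ is a $\mathcal Q$-ideal if $R/I\in\mathcal Q$; the $\mathcal Q$-ideals of $R$, ordered by inclusion, form a lattice in which $I\wedge J=I\cap J$ and $I\vee J$ is the least $\mathcal Q$-ideal containing $I\cup J$. The quasivariety $\mathcal Q$ is relatively ideal distributive if for every $R\in\mathcal Q$ this lattice satisfies $I\wedge(J\vee K)=(I\wedge J)\vee(I\wedge K)$. Theorem. Let $n$ be a positive integer, and let $\mathcal Q_{|n}$ be the quasivariety generated by the class of integral domains whose group of units is cyclic of order dividing $n$. (1) $\mathcal Q_{|n}$ is axiomatized by (a) the identities defining commutative rings, (b) the quasi-identity $(x^2=0)\to(x=0)$, and (c) the quasi-identity $(xyz=z)\to(y^nz=z)$. (2) $\mathcal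 Q_{|n}$ is a relatively ideal distributive quasivariety. -/

import Mathlib

universe u

namespace RingQuasivariety

open FirstOrder

/-- Terms in the language `{+, *, -, 0, 1}` of rings, in countably many variables. -/
abbrev RingTerm : Type := Language.ring.Term ℕ

/-- Algebras in the language of rings: a type with operations `+, *, -, 0, 1`, no laws assumed.
A class of algebras is a term of type `Set RingAlg`. -/
abbrev RingAlg : Type (u + 1) := CategoryTheory.Bundled.{u} Language.ring.Structure

/-- The algebra in the language of rings underlying a commutative ring. -/
def algOf (R : Type u) [CommRing R] : RingAlg.{u} :=
  ⟨R, (Ring.compatibleRingOfRing R).toStructure⟩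

/-- A quasi-identity `(s₁ = t₁) ∧ ... ∧ (s_k = t_k) → (s₀ = t₀)`; the list of premises may be
empty, and then the quasi-identity is an identity. -/
structure QuasiIdentity where
  /-- the pairs `(s_i, t_i)` for `1 ≤ i ≤ k` -/
  premises : List (RingTerm × RingTerm)
  /-- the pair `(s₀, t₀)` -/
  conclusion : RingTerm × RingTerm

/-- The universally quantified quasi-identity `q` holds in the algebra `A`. -/
def QuasiIdentity.Holds (q : QuasiIdentity) (A : RingAlg.{u}) : Prop :=
  letI := A.str
  ∀ v : ℕ → A.α, (∀ e ∈ q.premises, e.1.realize v = e.2.realize v) →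
    q.conclusion.1.realize v = q.conclusion.2.realize v

/-- An identity `s = t`, that is, a quasi-identity without premises. -/
def identity (s t : RingTerm) : QuasiIdentity := ⟨[], (s, t)⟩

/-- The class of algebras axiomatized by a set of quasi-identities. -/
def axiomatizedBy (T : Set QuasiIdentity) : Set RingAlg.{u} :=
  {A | ∀ q ∈ T, q.Holds A}

/-- A quasivariety is a class axiomatized by quasi-identities. -/
def IsQuasivariety (Q : Set RingAlg.{u}) : Prop :=
  ∃ T : Set QuasiIdentity, Q = axiomatizedBy T

/-- The quasivariety generated by a class: the intersection of all quasivarieties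
containing it. -/
def generatedQuasivariety (K : Set RingAlg.{u}) : Set RingAlg.{u} :=
  ⋂₀ {Q | IsQuasivariety Q ∧ K ⊆ Q}

/-- The domains whose unit group is (finite) cyclic of order dividing `n`, where `0 < n`. -/
def domainsUnitsDvd (n : ℕ) : Set RingAlg.{u} :=
  {A | ∃ (D : Type u) (_ : CommRing D),
    IsDomain D ∧ IsCyclic Dˣ ∧ Nat.card Dˣ ∣ n ∧ A = algOf D}

/-- The quasivariety generated by the domains whose unit group is cyclic of order
dividing `n`. -/
def quasivarietyUnitsDvd (n : ℕ) : Set RingAlg.{u} :=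
  generatedQuasivariety (domainsUnitsDvd n)

/-- The variables. -/
abbrev X (i : ℕ) : RingTerm := Language.Term.var i

/-- The term `t ^ n`, i.e. `((1 * t) * t) * ... * t`. -/
def powTerm (t : RingTerm) : ℕ → RingTerm
  | 0 => 1
  | n + 1 => powTerm t n * t

/-- The identities defining commutative rings (with `1`). -/
def commRingIdentities : Set QuasiIdentity :=
  { identity ((X 0 + X 1) + X 2) (X 0 + (X 1 + X 2)),
    identity (X 0 + X 1) (X 1 + X 0),
    identity (0 + X 0) (X 0),
    identity (-X 0 + X 0) 0,
    identity ((X 0 * X 1) * X 2) (X 0 * (X 1 * X 2)),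
    identity (X 0 * X 1) (X 1 * X 0),
    identity (1 * X 0) (X 0),
    identity (X 0 * (X 1 + X 2)) (X 0 * X 1 + X 0 * X 2) }

/-- The quasi-identity `(x² = 0) → (x = 0)`. -/
def reducedAxiom : QuasiIdentity := ⟨[(X 0 * X 0, 0)], (X 0, 0)⟩

/-- The quasi-identity `(x y z = z) → (yⁿ z = z)`. -/
def unitPowAxiom (n : ℕ) : QuasiIdentity :=
  ⟨[(X 0 * X 1 * X 2, X 2)], (powTerm (X 1) n * X 2, X 2)⟩

/-- `I` is a relative ideal (a `Q`-ideal) of the commutative ring `R`: `R ⧸ I` lies in `Q`. -/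
def IsRelIdeal (Q : Set RingAlg.{u}) {R : Type u} [CommRing R] (I : Ideal R) : Prop :=
  algOf (R ⧸ I) ∈ Q

/-- The join in the lattice of `Q`-ideals: the least `Q`-ideal containing `I` and `J`
(see `isLeast_relJoin`). -/
def relJoin (Q : Set RingAlg.{u}) {R : Type u} [CommRing R] (I J : Ideal R) : Ideal R :=
  sInf {K | IsRelIdeal Q K ∧ I ≤ K ∧ J ≤ K}

/-- `Q` is a relatively ideal distributive quasivariety: for every commutative ring `R` in `Q`,
the lattice of `Q`-ideals of `R` (with intersection as meet and `relJoin` as join)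
is distributive. -/
def RelativelyIdealDistributive (Q : Set RingAlg.{u}) : Prop :=
  IsQuasivariety Q ∧
    ∀ (R : Type u) [CommRing R], algOf R ∈ Q →
      ∀ I J K : Ideal R, IsRelIdeal Q I → IsRelIdeal Q J → IsRelIdeal Q K →
        I ⊓ relJoin Q J K = relJoin Q (I ⊓ J) (I ⊓ K)

/-! The join is well defined: intersections of relative ideals are relative ideals. -/

theorem holds_algOf (q : QuasiIdentity) (R : Type u) [CommRing R] :
    q.Holds (algOf R) ↔
      letI := Ring.compatibleRingOfRing R
      ∀ v : ℕ → R, (∀ e ∈ q.premises, e.1.realize v = e.2.realize v) →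
        q.conclusion.1.realize v = q.conclusion.2.realize v :=
  Iff.rfl

theorem realize_mk {R : Type u} [CommRing R] (I : Ideal R) (w : ℕ → R) (t : RingTerm) :
    letI := Ring.compatibleRingOfRing R
    letI := Ring.compatibleRingOfRing (R ⧸ I)
    t.realize (fun i => Ideal.Quotient.mk I (w i)) = Ideal.Quotient.mk I (t.realize w) := by
  induction t with
  | var i => rfl
  | func f ts ih =>
    cases f
    · exact (congrArg₂ (fun a b : R ⧸ I => a + b) (ih 0) (ih 1)).trans
        (map_add (Ideal.Quotient.mk I) _ _).symm
    · exact (congrArg₂ (fun a b : R ⧸ I => a * b) (ih 0) (ih 1)).trans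
        (map_mul (Ideal.Quotient.mk I) _ _).symm
    · exact (congrArg (fun a : R ⧸ I => -a) (ih 0)).trans (map_neg (Ideal.Quotient.mk I) _).symm
    · exact (map_zero (Ideal.Quotient.mk I)).symm
    · exact (map_one (Ideal.Quotient.mk I)).symm

theorem IsRelIdeal.sInf {Q : Set RingAlg.{u}} (hQ : IsQuasivariety Q) {R : Type u} [CommRing R]
    {S : Set (Ideal R)} (hS : ∀ K ∈ S, IsRelIdeal Q K) : IsRelIdeal Q (sInf S) := by
  obtain ⟨T, rfl⟩ := hQ
  intro q hq
  rw [holds_algOf]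
  intro v hv
  obtain ⟨w, rfl⟩ : ∃ w : ℕ → R, v = fun i => Ideal.Quotient.mk (InfSet.sInf S) (w i) := by
    choose w hw using fun i => Ideal.Quotient.mk_surjective (I := InfSet.sInf S) (v i)
    exact ⟨w, funext fun i => (hw i).symm⟩
  rw [realize_mk, realize_mk, Ideal.Quotient.mk_eq_mk_iff_sub_mem, Submodule.mem_sInf]
  intro K hK
  rw [← Ideal.Quotient.mk_eq_mk_iff_sub_mem, ← realize_mk, ← realize_mk]
  refine (holds_algOf q _).1 (hS K hK q hq) _ fun e he => ?_
  have h := hv e he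
  rw [realize_mk, realize_mk, Ideal.Quotient.mk_eq_mk_iff_sub_mem] at h ⊢
  exact Submodule.mem_sInf.1 h K hK

theorem isLeast_relJoin {Q : Set RingAlg.{u}} (hQ : IsQuasivariety Q) {R : Type u} [CommRing R]
    (I J : Ideal R) : IsLeast {K | IsRelIdeal Q K ∧ I ≤ K ∧ J ≤ K} (relJoin Q I J) :=
  ⟨⟨IsRelIdeal.sInf hQ fun _ h => h.1, le_sInf fun _ h => h.2.1, le_sInf fun _ h => h.2.2⟩,
    fun _ h => sInf_le h⟩

end RingQuasivariety

/-! Both claims follow from one fact: if `R ⧸ I` satisfies the axioms, `I` is an intersection of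
primes `P` with `R ⧸ P` a generating domain. Indeed `I` is radical, hence the intersection of its
minimal primes. If `xy ≡ 1` modulo such a `P`, some `s ∉ P` satisfies `s(xy - 1) ∈ I`, so axiom (c)
with `z = s` gives `(yⁿ - 1)s ∈ I ≤ P` and `yⁿ ≡ 1` modulo `P`. All units of the domain `R ⧸ P` are
then `n`-th roots of unity, so they form a finite cyclic group of order dividing `n`.

For (1), take `I = ⊥` and test quasi-identities in the quotients `R ⧸ P`. For (2), these primes are
themselves relative ideals, and a prime above `I ⊓ J` lies above `I` or `J`. -/

/-- If `I` is radical and `P` is a minimal prime over `I`, every element of `P` is multiplied into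
`I` by some element outside `P`. -/
theorem Ideal.IsRadical.exists_notMem_mul_mem {R : Type*} [CommRing R] {I P : Ideal R}
    (hI : I.IsRadical) (hP : P ∈ I.minimalPrimes) {a : R} (ha : a ∈ P) : ∃ s ∉ P, s * a ∈ I := by
  have : P.IsPrime := hP.1.1
  have h : algebraMap R (Localization.AtPrime P) a ∈
      (I.map (algebraMap R (Localization.AtPrime P))).radical := by
    -- Since `P` is minimal over `I`, the extension of `I` to the localization at `P` has the
    -- extension of `P` as its radical.
    rw [IsLocalization.AtPrime.radical_map_of_mem_minimalPrimes _ _ _ hP]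
    exact Ideal.mem_map_of_mem _ ha
  obtain ⟨k, hk⟩ := h
  rw [← map_pow, IsLocalization.algebraMap_mem_map_algebraMap_iff P.primeCompl] at hk
  obtain ⟨s, hs, hsa⟩ := hk
  -- Only `s * a ^ k ∈ I` is known; one more factor `a` and powers of `s` turn this into a power of
  -- `s * a`, and radicality removes the exponent.
  refine ⟨s, hs, hI ⟨k + 1, ?_⟩⟩
  have : (s * a) ^ (k + 1) = s ^ k * a * (s * a ^ k) := by ring
  exact this ▸ I.mul_mem_left _ hsa

/-- A domain in which the unit group has exponent dividing `n > 0` has a cyclic unit group of order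
dividing `n`. -/
theorem isCyclic_units_and_card_dvd {D : Type*} [CommRing D] [IsDomain D] {n : ℕ} (hn : 0 < n)
    (h : ∀ u : Dˣ, u ^ n = 1) : IsCyclic Dˣ ∧ Nat.card Dˣ ∣ n := by
  have : NeZero n := ⟨hn.ne'⟩
  have htop : rootsOfUnity n D = ⊤ := by
    ext u
    simpa [mem_rootsOfUnity] using h u
  have : Finite Dˣ := by
    have : Finite (⊤ : Subgroup Dˣ) := htop ▸ (inferInstance : Finite (rootsOfUnity n D))
    exact Finite.of_equiv _ (Subgroup.topEquiv (G := Dˣ)).toEquiv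
  have hc : IsCyclic Dˣ := inferInstance
  exact ⟨hc, IsCyclic.exponent_eq_card (α := Dˣ) ▸ Monoid.exponent_dvd_of_forall_pow_eq_one h⟩

namespace RingQuasivariety

open FirstOrder

/-! ### Translation between algebras satisfying the axioms and commutative rings. -/

theorem algOf_ext {A : RingAlg.{u}} [CommRing A.α]
    (hadd : ∀ x : Fin 2 → A.α, A.str.funMap Ring.addFunc x = x 0 + x 1)
    (hmul : ∀ x : Fin 2 → A.α, A.str.funMap Ring.mulFunc x = x 0 * x 1)
    (hneg : ∀ x : Fin 1 → A.α, A.str.funMap Ring.negFunc x = -x 0)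
    (hzero : ∀ x : Fin 0 → A.α, A.str.funMap Ring.zeroFunc x = 0)
    (hone : ∀ x : Fin 0 → A.α, A.str.funMap Ring.oneFunc x = 1) : A = algOf A.α := by
  obtain ⟨α, str⟩ := A
  refine congrArg (fun S => (⟨α, S⟩ : RingAlg)) (Language.Structure.ext ?_ ?_)
  · ext k f x
    cases f
    exacts [hadd x, hmul x, hneg x, hzero x, hone x]
  · ext k r
    exact r.elim

theorem exists_eq_algOf {A : RingAlg.{u}} (hA : A ∈ axiomatizedBy commRingIdentities) :
    ∃ (R : Type u) (_ : CommRing R), A = algOf R := by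
  let := A.str
  let := Ring.addOfRingStructure A.α
  let := Ring.mulOfRingStructure A.α
  let := Ring.negOfRingStructure A.α
  let := Ring.zeroOfRingStructure A.α
  let := Ring.oneOfRingStructure A.α
  let := Ring.compatibleRingOfRingStructure A.α
  have key : ∀ s t : RingTerm, identity s t ∈ commRingIdentities → ∀ v : ℕ → A.α,
      s.realize v = t.realize v := fun s t h v => hA _ h v (by simp [identity])
  let val (a b c : A.α) : ℕ → A.α := fun i => if i = 0 then a else if i = 1 then b else c
  have hmulcomm : ∀ a b : A.α, a * b = b * a := fun a b => by
    simpa [val] using key (X 0 * X 1) (X 1 * X 0) (by simp [commRingIdentities]) (val a b a)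
  let : CommRing A.α := CommRing.ofMinimalAxioms
    (fun a b c => by
      simpa [val] using key ((X 0 + X 1) + X 2) (X 0 + (X 1 + X 2))
        (by simp [commRingIdentities]) (val a b c))
    (fun a => by
      simpa [val] using key (0 + X 0) (X 0) (by simp [commRingIdentities]) (val a a a))
    (fun a => by
      simpa [val] using key (-X 0 + X 0) 0 (by simp [commRingIdentities]) (val a a a))
    (fun a b c => by
      simpa [val] using key ((X 0 * X 1) * X 2) (X 0 * (X 1 * X 2))
        (by simp [commRingIdentities]) (val a b c))
    hmulcomm
    (fun a => by
      simpa [val] using key (1 * X 0) (X 0) (by simp [commRingIdentities]) (val a a a))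
    (fun a b c => by
      simpa [val] using key (X 0 * (X 1 + X 2)) (X 0 * X 1 + X 0 * X 2)
        (by simp [commRingIdentities]) (val a b c))
  exact ⟨A.α, inferInstance, algOf_ext Ring.CompatibleRing.funMap_add
    Ring.CompatibleRing.funMap_mul Ring.CompatibleRing.funMap_neg
    Ring.CompatibleRing.funMap_zero Ring.CompatibleRing.funMap_one⟩

theorem algOf_mem_commRing (R : Type u) [CommRing R] :
    algOf R ∈ axiomatizedBy commRingIdentities := by
  let := Ring.compatibleRingOfRing R
  intro q hq
  rw [holds_algOf]
  intro v _
  simp only [commRingIdentities, Set.mem_insert_iff, Set.mem_singleton_iff] at hq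
  rcases hq with rfl | rfl | rfl | rfl | rfl | rfl | rfl | rfl <;>
    simp [identity, add_assoc, mul_assoc, add_comm, mul_comm, mul_add]

theorem reducedAxiom_holds_iff {R : Type u} [CommRing R] :
    reducedAxiom.Holds (algOf R) ↔ ∀ x : R, x * x = 0 → x = 0 := by
  let := Ring.compatibleRingOfRing R
  rw [holds_algOf]
  simp only [reducedAxiom, List.mem_singleton, forall_eq, Ring.realize_mul, Ring.realize_zero,
    Language.Term.realize_var]
  exact ⟨fun h x => h fun _ => x, fun h v => h (v 0)⟩

theorem realize_powTerm {R : Type u} [CommRing R] (t : RingTerm) (v : ℕ → R) (n : ℕ) :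
    letI := Ring.compatibleRingOfRing R
    (powTerm t n).realize v = t.realize v ^ n := by
  let := Ring.compatibleRingOfRing R
  induction n with
  | zero => simp [powTerm]
  | succ n ih => simp [powTerm, ih, pow_succ]

theorem unitPowAxiom_holds_iff {R : Type u} [CommRing R] {n : ℕ} :
    (unitPowAxiom n).Holds (algOf R) ↔ ∀ x y z : R, x * y * z = z → y ^ n * z = z := by
  let := Ring.compatibleRingOfRing R
  rw [holds_algOf]
  simp only [unitPowAxiom, List.mem_singleton, forall_eq, Ring.realize_mul, realize_powTerm,
    Language.Term.realize_var]
  exact ⟨fun h x y z => h fun i => if i = 0 then x else if i = 1 then y else z,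
    fun h v => h (v 0) (v 1) (v 2)⟩

/-- The proposed axioms for the quasivariety `quasivarietyUnitsDvd n`. -/
abbrev unitsDvdAxioms (n : ℕ) : Set QuasiIdentity :=
  commRingIdentities ∪ {reducedAxiom, unitPowAxiom n}

theorem algOf_mem_unitsDvdAxioms_iff {R : Type u} [CommRing R] {n : ℕ} :
    algOf R ∈ axiomatizedBy (unitsDvdAxioms n) ↔
      (∀ x : R, x * x = 0 → x = 0) ∧ ∀ x y z : R, x * y * z = z → y ^ n * z = z := by
  rw [← reducedAxiom_holds_iff, ← unitPowAxiom_holds_iff]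
  refine ⟨fun h => ⟨h _ (by simp), h _ (by simp)⟩, fun ⟨h₁, h₂⟩ q hq => ?_⟩
  rcases hq with hq | rfl | rfl
  exacts [algOf_mem_commRing R q hq, h₁, h₂]

/-! ### Generating domains as quotients by primes. -/

theorem domainsUnitsDvd_subset {n : ℕ} (hn : 0 < n) :
    domainsUnitsDvd.{u} n ⊆ axiomatizedBy (unitsDvdAxioms n) := by
  rintro _ ⟨D, _, _, _, hcard, rfl⟩
  refine algOf_mem_unitsDvdAxioms_iff.2 ⟨fun x hx => mul_self_eq_zero.1 hx, fun x y z h => ?_⟩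
  obtain rfl | hz := eq_or_ne z 0
  · simp
  have hxy : x * y = 1 := mul_right_cancel₀ hz (h.trans (one_mul z).symm)
  have hu : (Units.mkOfMulEqOne y x (mul_comm x y ▸ hxy)) ^ n = 1 := by
    obtain ⟨k, rfl⟩ := hcard
    -- No finiteness is needed here: for an infinite group `Nat.card` is `0`, and the zeroth power
    -- is `1`.
    rw [pow_mul, pow_card_eq_one', one_pow]
  have hy : y ^ n = 1 := by simpa using congrArg Units.val hu
  rw [hy, one_mul]

theorem isRadical_of_algOf_mem {R : Type u} [CommRing R] {I : Ideal R} {n : ℕ}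
    (h : algOf (R ⧸ I) ∈ axiomatizedBy (unitsDvdAxioms n)) : I.IsRadical := by
  have := (algOf_mem_unitsDvdAxioms_iff.1 h).1
  rw [Ideal.isRadical_iff_quotient_reduced, isReduced_iff_pow_one_lt 2 one_lt_two]
  exact fun x hx => this x (by rw [← sq, hx])

/-- The quotient by a minimal prime over a relative ideal is a generating domain. -/
theorem algOf_quotient_mem_of_mem_minimalPrimes {n : ℕ} (hn : 0 < n) {R : Type u} [CommRing R]
    {I P : Ideal R} (hI : algOf (R ⧸ I) ∈ axiomatizedBy (unitsDvdAxioms n))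
    (hP : P ∈ I.minimalPrimes) : algOf (R ⧸ P) ∈ domainsUnitsDvd n := by
  have : P.IsPrime := hP.1.1
  have hpow : ∀ u : (R ⧸ P)ˣ, u ^ n = 1 := fun u => by
    obtain ⟨x, hx⟩ := Ideal.Quotient.mk_surjective (↑u⁻¹ : R ⧸ P)
    obtain ⟨y, hy⟩ := Ideal.Quotient.mk_surjective (u : R ⧸ P)
    have hxy : x * y - 1 ∈ P := by
      rw [← Ideal.Quotient.mk_eq_mk_iff_sub_mem, map_mul, hx, hy, map_one, Units.inv_mul]
    obtain ⟨s, hs, hsI⟩ := (isRadical_of_algOf_mem hI).exists_notMem_mul_mem hP hxy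
    have h := (algOf_mem_unitsDvdAxioms_iff.1 hI).2 (Ideal.Quotient.mk I x)
      (Ideal.Quotient.mk I y) (Ideal.Quotient.mk I s) (by
        rw [← map_mul, ← map_mul, Ideal.Quotient.mk_eq_mk_iff_sub_mem]
        convert hsI using 1
        ring)
    rw [← map_pow, ← map_mul, Ideal.Quotient.mk_eq_mk_iff_sub_mem] at h
    have hyn : y ^ n - 1 ∈ P :=
      (this.mem_or_mem (by convert hP.1.2 h using 1; ring : (y ^ n - 1) * s ∈ P)).resolve_right hs
    ext
    rw [← Ideal.Quotient.mk_eq_mk_iff_sub_mem, map_pow, hy, map_one] at hyn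
    simpa using hyn
  obtain ⟨hc, hd⟩ := isCyclic_units_and_card_dvd hn hpow
  exact ⟨R ⧸ P, inferInstance, inferInstance, hc, hd, rfl⟩

/-- Over a relative ideal, membership is detected by the primes whose quotient is a generating
domain. -/
theorem mem_of_forall_prime {n : ℕ} (hn : 0 < n) {R : Type u} [CommRing R]
    {I : Ideal R} (hI : algOf (R ⧸ I) ∈ axiomatizedBy (unitsDvdAxioms n)) {a : R}
    (ha : ∀ P : Ideal R, P.IsPrime → I ≤ P → algOf (R ⧸ P) ∈ domainsUnitsDvd n → a ∈ P) :
    a ∈ I := by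
  rw [← (isRadical_of_algOf_mem hI).radical, ← Ideal.sInf_minimalPrimes, Submodule.mem_sInf]
  exact fun P hP => ha P hP.1.1 hP.1.2 (algOf_quotient_mem_of_mem_minimalPrimes hn hI hP)

/-- Lets `mem_of_forall_prime` be applied to the zero ideal of `R`. -/
theorem algOf_quotient_bot_mem {n : ℕ} {R : Type u} [CommRing R]
    (hR : algOf R ∈ axiomatizedBy (unitsDvdAxioms n)) :
    algOf (R ⧸ (⊥ : Ideal R)) ∈ axiomatizedBy (unitsDvdAxioms n) := by
  rw [algOf_mem_unitsDvdAxioms_iff] at hR ⊢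
  let e := RingEquiv.quotientBot R
  refine ⟨fun x hx => e.injective ?_, fun x y z h => e.injective ?_⟩
  · simpa using hR.1 (e x) (by rw [← map_mul, hx, map_zero])
  · simpa using hR.2 (e x) (e y) (e z) (by rw [← map_mul, ← map_mul, h])

/-- Premises pass from `R` to each `R ⧸ P`, where the quasi-identity holds; so the two sides of the
conclusion differ by an element of every such `P`, that is, by zero. -/
theorem axiomatizedBy_subset_generated {n : ℕ} (hn : 0 < n) :
    axiomatizedBy.{u} (unitsDvdAxioms n) ⊆ quasivarietyUnitsDvd n := by
  rintro A hA _ ⟨⟨T, rfl⟩, hT⟩ q hq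
  obtain ⟨R, _, rfl⟩ := exists_eq_algOf fun q hq => hA q (Or.inl hq)
  rw [holds_algOf]
  intro v hv
  rw [← sub_eq_zero, ← Ideal.mem_bot]
  refine mem_of_forall_prime hn (algOf_quotient_bot_mem hA) fun P _ _ hP => ?_
  rw [← Ideal.Quotient.mk_eq_mk_iff_sub_mem, ← realize_mk, ← realize_mk]
  refine (holds_algOf q _).1 (hT hP q hq) _ fun e he => ?_
  rw [realize_mk, realize_mk, hv e he]

theorem quasivarietyUnitsDvd_eq {n : ℕ} (hn : 0 < n) :
    quasivarietyUnitsDvd.{u} n = axiomatizedBy (unitsDvdAxioms n) :=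
  (Set.sInter_subset_of_mem (And.intro ⟨_, rfl⟩ (domainsUnitsDvd_subset hn))).antisymm
    (axiomatizedBy_subset_generated hn)

/-! ### Distributivity of the relative ideals. -/

theorem relativelyIdealDistributive_axiomatizedBy {n : ℕ} (hn : 0 < n) :
    RelativelyIdealDistributive (axiomatizedBy.{u} (unitsDvdAxioms n)) := by
  have hQ : IsQuasivariety (axiomatizedBy.{u} (unitsDvdAxioms n)) := ⟨_, rfl⟩
  refine ⟨hQ, fun R _ _ I J K hI _ _ => le_antisymm (fun a ha => ?_) ?_⟩
  · obtain ⟨⟨hL, hIJ, hIK⟩, -⟩ := isLeast_relJoin hQ (I ⊓ J) (I ⊓ K)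
    refine mem_of_forall_prime hn hL fun P hPrime hLP hP => ?_
    by_cases hIP : I ≤ P
    · exact hIP ha.1
    · have hJ := (hPrime.inf_le.1 (hIJ.trans hLP)).resolve_left hIP
      have hK := (hPrime.inf_le.1 (hIK.trans hLP)).resolve_left hIP
      -- `P` is itself a relative ideal above `J` and `K`, so it contains their join.
      exact (isLeast_relJoin hQ J K).2 ⟨domainsUnitsDvd_subset hn hP, hJ, hK⟩ ha.2
  · obtain ⟨⟨hJK, hJ, hK⟩, -⟩ := isLeast_relJoin hQ J K
    refine (isLeast_relJoin hQ _ _).2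
      ⟨?_, inf_le_inf_left I hJ, inf_le_inf_left I hK⟩
    rw [← sInf_pair]
    refine IsRelIdeal.sInf hQ fun L hL => ?_
    rcases hL with rfl | rfl
    exacts [hI, hJK]

end RingQuasivariety

/-- The quasivariety generated by the domains with unit group cyclic of order dividing `n` is
axiomatized by the identities of commutative rings, `(x² = 0) → (x = 0)` and
`(x y z = z) → (yⁿ z = z)`, and it is a relatively ideal distributive quasivariety. -/
theorem theorem3p1 (n : ℕ) (hn : 0 < n) :
    RingQuasivariety.quasivarietyUnitsDvd.{u} n =
        RingQuasivariety.axiomatizedBy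
          (RingQuasivariety.commRingIdentities ∪
            {RingQuasivariety.reducedAxiom, RingQuasivariety.unitPowAxiom n}) ∧
      RingQuasivariety.RelativelyIdealDistributive
        (RingQuasivariety.quasivarietyUnitsDvd.{u} n) :=
  ⟨RingQuasivariety.quasivarietyUnitsDvd_eq hn, RingQuasivariety.quasivarietyUnitsDvd_eq hn ▸
    RingQuasivariety.relativelyIdealDistributive_axiomatizedBy hn⟩
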